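/- An ALD-system is a set $S$ with two binary operations $*$ and $\circ$ satisfying, for all $x,y,z\in S$, $$x*(y*z)=(x*y)*(x*z),\qquad x*(y*z)=(x\circ y)*z,\qquad x*(y\circ z)=(x*y)\circ(x*z).$$ Let $T_1^{*,\circ}$, $T_1^{*}$ and $T_1^{\circ}$ denote the sets of all formal binary terms constructed from a single variable $x$ using, respectively, both operators $*$ and $\circ$, the operator $*$ only, and the operator $\circ$ only. For $t\in T_1^{*,\circ}$ and $\gamma$ an element of an ALD-system $S$, let $t(\gamma)\in S$ denote the evaluation of $t$ at $x=\gamma$. If $v\in T_1^{\circ}$ contains exactly $p$ occurrences of $x$ and $\vec s=(s_1,\dots,s_p)$ is a sequence of terms of $T_1^{*}$, let $v[\vec s]\in T_1^{*,\circ}$ be the term obtained from $v$ by replacing, for $i=1,\dots,p$, the $i$-th occurrence of $x$ from the left with $s_i$. For $u,v\in T_1^{\circ}$, define $u<v$ recursively to mean that either (i) $u=x$ and $v\neq x$, or (ii) $u=u_1\circ u_2$ and $v=v_1\circ v_2$ with $u_1<v_1$, or (iii) $u=u_1\circ u_2$ and $v=v_1\circ v_2$ with $u_1=v_1$ and $u_2<v_2$;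 this is a strict linear order. For $s,t\in T_1^{*}$, write $s\sqsubset t$ if $t=(\cdots((s*t_1)*t_2)\cdots)*t_p$ for some $p\geq 1$ and some $t_1,\dots,t_p\in T_1^{*}$. For finite nonempty sequences $\vec s,\vec t$ of terms of $T_1^{*}$, write $\vec s\mathrel{\vec\sqsubset}\vec t$ if $\vec s$ and $\vec t$ have the same length and there is an index $k$ such that $s_i=t_i$ for all $i<k$ and $s_k\sqsubset t_k$. **Proposition 2.6.** Let $S$ be an ALD-system generated by an element $\gamma$. Then $S$ is a free ALD-system based on $\{\gamma\}$ (that is, for every ALD-system $A$ and every $a\in A$ there is exactly one homomorphism $f:S\to A$ with $f(\gamma)=a$) if and only if $S$ satisfies no equality of the form $$u[\vec s](\gamma)=v[\vec t](\gamma)$$ where $u,v\in T_1^{\circ}$ and $\vec s,\vec t$ are sequences of terms of $T_1^{*}$ whose lengths are the numbers of occurrences of $x$ in $u$ and in $v$, respectively, and where either $u<v$, or $u=v$ and $\vec s\mathrel{\vec\sqsubset}\vec t$. -/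

import Mathlib

universe u w

namespace ALD

open scoped Quandles

/-- An augmented LD-system: Mathlib's `Shelf`, that is, a set with an operation `∗` (written `◃`)
satisfying `x ∗ (y ∗ z) = (x ∗ y) ∗ (x ∗ z)`, together with a second operation `∘` (called `comp`)
satisfying the two mixed laws. -/
class ALDSystem (S : Type*) extends Shelf S where
  /-- The operation `∘`. -/
  comp : S → S → S
  act_act : ∀ x y z : S, x ◃ (y ◃ z) = comp x y ◃ z
  act_comp : ∀ x y z : S, x ◃ comp y z = comp (x ◃ y) (x ◃ z)

/-- `f` is a homomorphism of ALD-systems: it preserves both operations. -/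
def IsHom {S T : Type*} [ALDSystem S] [ALDSystem T] (f : S → T) : Prop :=
  (∀ x y, f (x ◃ y) = f x ◃ f y) ∧
    ∀ x y, f (ALDSystem.comp x y) = ALDSystem.comp (f x) (f y)

/-- `S` is generated by `γ`: the only subset of `S` that contains `γ` and is closed under both
operations is `S` itself. -/
def GeneratedBy (S : Type*) [ALDSystem S] (γ : S) : Prop :=
  ∀ A : Set S, γ ∈ A → (∀ x ∈ A, ∀ y ∈ A, x ◃ y ∈ A) →
    (∀ x ∈ A, ∀ y ∈ A, ALDSystem.comp x y ∈ A) → A = Set.univ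

/-- `S` is a free ALD-system based on `{γ}`: every map from `{γ}` to an ALD-system extends uniquely
to a homomorphism defined on `S`. -/
def IsFreeOn (S : Type u) [ALDSystem S] (γ : S) : Prop :=
  ∀ (T : Type w) [ALDSystem T] (a : T), ∃! f : S → T, IsHom f ∧ f γ = a

/-- Terms in one variable `x` constructed using both operators `∗` and `∘`. -/
inductive Term : Type
  | x : Term
  | star : Term → Term → Term
  | comp : Term → Term → Term

/-- Terms in one variable `x` constructed using the operator `∗` only. -/
inductive StarTerm : Type
  | x : StarTerm
  | star : StarTerm → StarTerm → StarTerm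

/-- Terms in one variable `x` constructed using the operator `∘` only. -/
inductive CompTerm : Type
  | x : CompTerm
  | comp : CompTerm → CompTerm → CompTerm

/-- The evaluation `t(γ)` of a term `t` at an element `γ` of an ALD-system. -/
def Term.eval {S : Type*} [ALDSystem S] (γ : S) : Term → S
  | .x => γ
  | .star s t => s.eval γ ◃ t.eval γ
  | .comp s t => ALDSystem.comp (s.eval γ) (t.eval γ)

/-- The inclusion of the `∗`-terms in the set of all terms. -/
def StarTerm.toTerm : StarTerm → Term
  | .x => .x
  | .star s t => .star s.toTerm t.toTerm

/-- The size of a `∘`-term: the number of occurrences of the variable. -/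
def CompTerm.size : CompTerm → ℕ
  | .x => 1
  | .comp u v => u.size + v.size

/-- The term `v[s₁, …, s_p]`, where `p` is the size of the `∘`-term `v`: the `i`-th occurrence of
the variable in `v`, from left to right, is replaced with the `∗`-term `s_i`. -/
def CompTerm.subst : (v : CompTerm) → (Fin v.size → StarTerm) → Term
  | .x, s => (s (0 : Fin 1)).toTerm
  | .comp u v, s =>
      .comp (u.subst fun i => s (Fin.castAdd v.size i)) (v.subst fun i => s (Fin.natAdd u.size i))

/-- The linear ordering `<` of the `∘`-terms. -/
inductive CompTerm.Less : CompTerm → CompTerm → Prop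
  | base {v : CompTerm} : v ≠ .x → CompTerm.Less .x v
  | left {u₁ u₂ v₁ v₂ : CompTerm} : CompTerm.Less u₁ v₁ →
      CompTerm.Less (.comp u₁ u₂) (.comp v₁ v₂)
  | right {u₁ u₂ v₂ : CompTerm} : CompTerm.Less u₂ v₂ →
      CompTerm.Less (.comp u₁ u₂) (.comp u₁ v₂)

/-- `s ⊏ t`: the `∗`-term `s` is a proper iterated left subterm of `t`, that is,
`t = (⋯((s ∗ t₁) ∗ t₂)⋯) ∗ t_p` for some `p ≥ 1` and some `∗`-terms `t₁, …, t_p`. -/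
def StarTerm.IterLeft (s t : StarTerm) : Prop :=
  ∃ l : List StarTerm, l ≠ [] ∧ t = l.foldl StarTerm.star s

/-- The lexicographic extension of `⊏` to sequences of the same length `p`: for some `k`, one has
`s_i = t_i` for all `i < k`, and `s_k ⊏ t_k`. -/
def SeqIterLeft {p : ℕ} (s t : Fin p → StarTerm) : Prop :=
  ∃ k : Fin p, (∀ i < k, s i = t i) ∧ (s k).IterLeft (t k)

end ALD

/-! Pushing `∗` inside `∘` by the mixed laws rewrites every term as a binary tree of `∗`-terms
without changing its value. Freeness thus splits into a question about shapes and a question about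
leaves.

If there are no collisions, two terms with equal values at `γ` have trees of the same shape, since
`<` is total. Their leaves must then be LD-equivalent one by one: by `StarTerm.comparison`, at the
first inequivalent position the two leaves have equivalents related by `⊏`, which gives a collision.
Hence the two terms agree in every ALD-system. Comparison rests on confluence of LD-expansion and on
the absorption `t ∗ x^[n] ~ x^[n+1]` for large `n`.

If `S` is free, it maps to the system of trees over any shelf. There the shape can be read off the
value, so `u < v` cannot collide. For the leaves, a shelf is needed in which `s ⊏ t` forces distinct
values: shifted conjugacy on the automorphisms of a free group, where the quotient of the two values
is a product of factors `sh(b) σ sh(a)⁻¹`, each of which is positive in the sense of `IsPositive`.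
-/

namespace ALD

open scoped Quandles
open Relation

/-! ### LD-expansion of `∗`-terms and its confluence -/

namespace StarTerm

/-- The evaluation of a `∗`-term at an element of a shelf. -/
def eval {L : Type*} [Shelf L] (g : L) : StarTerm → L
  | .x => g
  | .star s t => s.eval g ◃ t.eval g

theorem eval_toTerm {S : Type*} [ALDSystem S] (γ : S) (s : StarTerm) :
    s.toTerm.eval γ = s.eval γ := by
  induction s with
  | x => rfl
  | star s t hs ht => simp only [toTerm, Term.eval, eval, hs, ht]

/-- One application of left self-distributivity, in the expanding direction, at some subterm. -/
inductive Step : StarTerm → StarTerm → Prop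
  | distrib (r s t : StarTerm) : Step (.star r (.star s t)) (.star (.star r s) (.star r t))
  | left {s s' : StarTerm} (t : StarTerm) : Step s s' → Step (.star s t) (.star s' t)
  | right (s : StarTerm) {t t' : StarTerm} : Step t t' → Step (.star s t) (.star s t')

/-- `t` is an LD-expansion of `s`. -/
abbrev Expands : StarTerm → StarTerm → Prop := ReflTransGen Step

theorem Step.eval_eq {L : Type*} [Shelf L] (g : L) {s t : StarTerm} (h : Step s t) :
    s.eval g = t.eval g := by
  induction h with
  | distrib r s t => exact Shelf.self_distrib
  | left t _ ih => simp only [eval, ih]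
  | right s _ ih => simp only [eval, ih]

theorem Expands.eval_eq {L : Type*} [Shelf L] (g : L) {s t : StarTerm} (h : Expands s t) :
    s.eval g = t.eval g := by
  induction h with
  | refl => rfl
  | tail _ h ih => exact ih.trans (h.eval_eq g)

theorem Expands.star {s s' t t' : StarTerm} (hs : Expands s s') (ht : Expands t t') :
    Expands (.star s t) (.star s' t') :=
  (hs.lift (fun r => StarTerm.star r t) fun _ _ h => h.left t).trans
    (ht.lift (fun r => StarTerm.star s' r) fun _ _ h => h.right s')

/-- `dist s t` distributes `s` to every occurrence of the variable in `t`. -/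
def dist (s : StarTerm) : StarTerm → StarTerm
  | .x => .star s .x
  | .star t₁ t₂ => .star (dist s t₁) (dist s t₂)

theorem expands_dist (s t : StarTerm) : Expands (.star s t) (dist s t) := by
  induction t with
  | x => exact .refl
  | star t₁ t₂ h₁ h₂ => exact .head (.distrib s t₁ t₂) (h₁.star h₂)

theorem Expands.dist_left {s s' : StarTerm} (h : Expands s s') (t : StarTerm) :
    Expands (dist s t) (dist s' t) := by
  induction t with
  | x => exact h.star .refl
  | star t₁ t₂ h₁ h₂ => exact h₁.star h₂

theorem Step.dist_right (s : StarTerm) {t t' : StarTerm} (h : Step t t') :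
    Step (dist s t) (dist s t') := by
  induction h with
  | distrib p q r => exact .distrib _ _ _
  | left t _ ih => exact .left _ ih
  | right t _ ih => exact .right _ ih

theorem Expands.dist {s s' t t' : StarTerm} (hs : Expands s s') (ht : Expands t t') :
    Expands (dist s t) (StarTerm.dist s' t') :=
  (hs.dist_left t).trans (ht.lift _ fun _ _ h => h.dist_right s')

/-- The factor `dist r p` is pushed down the copy of `q` only as far as the subterms `r ∗ x` that
replace its leaves. `dist_dist_expands` then pushes it through these. -/
theorem star_dist_expands (r p q : StarTerm) :
    Expands (.star (dist r p) (dist r q)) (dist r (dist p q)) := by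
  induction q with
  | x => exact .refl
  | star q₁ q₂ h₁ h₂ => exact .head (.distrib _ _ _) (h₁.star h₂)

theorem dist_dist_expands (r p q : StarTerm) :
    Expands (dist r (dist p q)) (dist (dist r p) (dist r q)) := by
  induction q with
  | x => exact expands_dist _ (.star r .x)
  | star q₁ q₂ h₁ h₂ => exact h₁.star h₂

/-- The term obtained by distributing everywhere; it is an expansion of all the terms that are
obtained from the original term in one step. -/
def full : StarTerm → StarTerm
  | .x => .x
  | .star s t => dist (full s) (full t)

theorem expands_full (t : StarTerm) : Expands t t.full := by
  induction t with
  | x => exact .refl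
  | star s t hs ht => exact (hs.star ht).trans (expands_dist _ _)

theorem Step.expands_full {s t : StarTerm} (h : Step s t) : Expands t s.full := by
  induction h with
  | distrib r p q =>
    have h (p : StarTerm) : Expands (.star r p) (StarTerm.dist r.full p.full) :=
      (r.expands_full.star p.expands_full).trans (expands_dist _ _)
    exact ((h p).star (h q)).trans (star_dist_expands _ _ _)
  | left t _ ih => exact (ih.star t.expands_full).trans (expands_dist _ _)
  | right s _ ih => exact (s.expands_full.star ih).trans (expands_dist _ _)

theorem Step.full_expands {s t : StarTerm} (h : Step s t) : Expands s.full t.full := by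
  induction h with
  | distrib r p q => exact dist_dist_expands _ _ _
  | left t _ ih => exact ih.dist .refl
  | right s _ ih => exact Expands.dist .refl ih

theorem Expands.full {s t : StarTerm} (h : Expands s t) : Expands s.full t.full := by
  induction h with
  | refl => exact .refl
  | tail _ h ih => exact ih.trans h.full_expands

theorem expands_iterate_full (t : StarTerm) (n : ℕ) : Expands t (StarTerm.full^[n] t) := by
  induction n with
  | zero => exact .refl
  | succ n ih =>
    rw [Function.iterate_succ_apply']
    exact ih.trans (StarTerm.expands_full _)

theorem Expands.exists_iterate_full {s t : StarTerm} (h : Expands s t) :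
    ∃ n, Expands t (StarTerm.full^[n] s) := by
  induction h with
  | refl => exact ⟨0, .refl⟩
  | tail _ h ih =>
    obtain ⟨n, hn⟩ := ih
    refine ⟨n + 1, ?_⟩
    rw [Function.iterate_succ_apply']
    exact h.expands_full.trans hn.full

/-- The iterates of `full` on `r` are cofinal among the expansions of `r`: one step is absorbed by
one `full`, and `full` is monotone. -/
theorem Expands.confluent {r s t : StarTerm} (hs : Expands r s) (ht : Expands r t) :
    Join Expands s t := by
  obtain ⟨m, hm⟩ := hs.exists_iterate_full
  obtain ⟨n, hn⟩ := ht.exists_iterate_full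
  refine ⟨StarTerm.full^[m + n] r, ?_, ?_⟩
  · rw [Nat.add_comm, Function.iterate_add_apply]
    exact hm.trans (expands_iterate_full _ _)
  · rw [Function.iterate_add_apply]
    exact hn.trans (expands_iterate_full _ _)

/-- LD-equivalence of `∗`-terms: the existence of a common LD-expansion. -/
def LDEquiv : StarTerm → StarTerm → Prop := Join Expands

theorem ldEquiv_equivalence : Equivalence LDEquiv :=
  equivalence_join fun _ _ _ hs ht => hs.confluent ht

theorem LDEquiv.refl (s : StarTerm) : LDEquiv s s := ldEquiv_equivalence.refl s

theorem LDEquiv.symm {s t : StarTerm} (h : LDEquiv s t) : LDEquiv t s := ldEquiv_equivalence.symm h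

theorem LDEquiv.trans {r s t : StarTerm} (h : LDEquiv r s) (h' : LDEquiv s t) : LDEquiv r t :=
  ldEquiv_equivalence.trans h h'

theorem Expands.ldEquiv {s t : StarTerm} (h : Expands s t) : LDEquiv s t := ⟨t, h, .refl⟩

theorem LDEquiv.star {s s' t t' : StarTerm} (hs : LDEquiv s s') (ht : LDEquiv t t') :
    LDEquiv (.star s t) (.star s' t') := by
  obtain ⟨p, hp, hp'⟩ := hs
  obtain ⟨q, hq, hq'⟩ := ht
  exact ⟨.star p q, hp.star hq, hp'.star hq'⟩

theorem LDEquiv.distrib (r s t : StarTerm) :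
    LDEquiv (.star r (.star s t)) (.star (.star r s) (.star r t)) :=
  Expands.ldEquiv (.single (.distrib r s t))

theorem LDEquiv.eval_eq {L : Type*} [Shelf L] (g : L) {s t : StarTerm} (h : LDEquiv s t) :
    s.eval g = t.eval g := by
  obtain ⟨r, hs, ht⟩ := h
  exact (hs.eval_eq g).trans (ht.eval_eq g).symm

/-! ### Absorption of right powers and the comparison property -/

/-- The right powers of the variable. -/
def rpow : ℕ → StarTerm
  | 0 => .x
  | n + 1 => .star .x (rpow n)

/-- Every term absorbs all sufficiently large right powers of the variable. -/
theorem exists_star_rpow (t : StarTerm) :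
    ∃ d, ∀ n ≥ d, LDEquiv (.star t (rpow n)) (rpow (n + 1)) := by
  induction t with
  | x => exact ⟨0, fun n _ => .refl _⟩
  | star s t hs ht =>
    obtain ⟨d, hd⟩ := hs
    obtain ⟨e, he⟩ := ht
    refine ⟨d + e + 1, fun n hn => ?_⟩
    obtain ⟨n, rfl⟩ : ∃ m, n = m + 1 := ⟨n - 1, by omega⟩
    -- `(s∗t)∗x^[n+1] ~ (s∗t)∗(s∗x^[n]) ~ s∗(t∗x^[n]) ~ s∗x^[n+1] ~ x^[n+2]`; peeling off one factor
    -- costs the extra 1 in the bound.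
    have h₁ := (LDEquiv.refl (.star s t)).star (hd n (by omega)).symm
    have h₂ := (LDEquiv.refl s).star (he n (by omega))
    exact h₁.trans ((LDEquiv.distrib s t (rpow n)).symm.trans (h₂.trans (hd (n + 1) (by omega))))

theorem not_iterLeft_x (s : StarTerm) : ¬ s.IterLeft .x := by
  rintro ⟨l, hl, h⟩
  obtain rfl | ⟨l, q, rfl⟩ := l.eq_nil_or_concat
  · exact hl rfl
  · simp at h

theorem iterLeft_star {s p q : StarTerm} : s.IterLeft (.star p q) ↔ s = p ∨ s.IterLeft p := by
  constructor
  · rintro ⟨l, hl, h⟩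
    obtain rfl | ⟨l, r, rfl⟩ := l.eq_nil_or_concat
    · exact absurd rfl hl
    · simp only [List.concat_eq_append, List.foldl_append, List.foldl_cons, List.foldl_nil,
        StarTerm.star.injEq] at h
      by_cases hl' : l = []
      · subst hl'
        exact .inl h.1.symm
      · exact .inr ⟨l, hl', h.1⟩
  · rintro (rfl | ⟨l, hl, rfl⟩)
    · exact ⟨[q], by simp, rfl⟩
    · exact ⟨l ++ [q], by simp, by simp⟩

/-- Only the leftmost branch matters: distributivity at the root lengthens it, and a step inside it
may expand `s` itself. -/
theorem IterLeft.of_step {s t t' : StarTerm} (hs : s.IterLeft t) (h : Step t t') :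
    ∃ s', Expands s s' ∧ s'.IterLeft t' := by
  induction h with
  | distrib r p q => exact ⟨s, .refl, iterLeft_star.2 (.inr (iterLeft_star.2 (iterLeft_star.1 hs)))⟩
  | left r h ih =>
    obtain rfl | hs := iterLeft_star.1 hs
    · exact ⟨_, .single h, iterLeft_star.2 (.inl rfl)⟩
    · obtain ⟨s', h₁, h₂⟩ := ih hs
      exact ⟨s', h₁, iterLeft_star.2 (.inr h₂)⟩
  | right r h ih => exact ⟨s, .refl, iterLeft_star.2 (iterLeft_star.1 hs)⟩

theorem IterLeft.of_expands {s t t' : StarTerm} (hs : s.IterLeft t) (h : Expands t t') :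
    ∃ s', Expands s s' ∧ s'.IterLeft t' := by
  induction h with
  | refl => exact ⟨s, .refl, hs⟩
  | tail _ h ih =>
    obtain ⟨s', h₁, h₂⟩ := ih
    obtain ⟨s'', h₃, h₄⟩ := h₂.of_step h
    exact ⟨s'', h₁.trans h₃, h₄⟩

theorem IterLeft.trichotomy {r s t : StarTerm} (hr : r.IterLeft t) (hs : s.IterLeft t) :
    r = s ∨ r.IterLeft s ∨ s.IterLeft r := by
  induction t with
  | x => exact absurd hr (not_iterLeft_x r)
  | star p q ih =>
    obtain rfl | hr := iterLeft_star.1 hr <;> obtain rfl | hs := iterLeft_star.1 hs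
    · exact .inl rfl
    · exact .inr (.inr hs)
    · exact .inr (.inl hr)
    · exact ih hr hs

/-- The comparison property of `∗`-terms in one variable: two inequivalent terms have equivalents
one of which is an iterated left subterm of the other. -/
theorem comparison (s t : StarTerm) :
    LDEquiv s t ∨
      ∃ s' t', LDEquiv s s' ∧ LDEquiv t t' ∧ (s'.IterLeft t' ∨ t'.IterLeft s') := by
  obtain ⟨d, hd⟩ := exists_star_rpow s
  obtain ⟨e, he⟩ := exists_star_rpow t
  -- Both products are equivalent to the same right power, so they share an expansion `r`.
  -- Expansions of `s` and `t` survive on the left branch of `r`, which is linearly ordered by `⊏`.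
  obtain ⟨r, hsr, htr⟩ :=
    (hd (d + e) (Nat.le_add_right d e)).trans (he (d + e) (Nat.le_add_left e d)).symm
  obtain ⟨s', hs, hs'⟩ := IterLeft.of_expands (iterLeft_star.2 (.inl rfl)) hsr
  obtain ⟨t', ht, ht'⟩ := IterLeft.of_expands (iterLeft_star.2 (.inl rfl)) htr
  obtain rfl | h := hs'.trichotomy ht'
  · exact .inl (hs.ldEquiv.trans ht.ldEquiv.symm)
  · exact .inr ⟨s', t', hs.ldEquiv, ht.ldEquiv, h⟩

end StarTerm

/-! ### Trees over a shelf, and normal forms of terms -/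

section Trees

variable {α : Type*}

/-- The extension of an operation on `α` to binary trees with leaves in `α`: a leaf acts on every
leaf of the second tree, and the leaves of the first tree act successively, from right to left. -/
def treeAct (op : α → α → α) : FreeMagma α → FreeMagma α → FreeMagma α
  | .of a, r => FreeMagma.map (op a) r
  | .mul p q, r => treeAct op p (treeAct op q r)

@[simp]
theorem treeAct_mul (op : α → α → α) (p q r : FreeMagma α) :
    treeAct op (p * q) r = treeAct op p (treeAct op q r) := rfl

@[simp]
theorem treeAct_mul_right (op : α → α → α) (p q r : FreeMagma α) :
    treeAct op p (q * r) = treeAct op p q * treeAct op p r := by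
  induction p using FreeMagma.recOnMul generalizing q r with
  | ih1 a => exact map_mul (FreeMagma.map (op a)) q r
  | ih2 p₁ p₂ h₁ h₂ => simp only [treeAct_mul, h₁, h₂]

theorem treeAct_self_distrib [Shelf α] (p q r : FreeMagma α) :
    treeAct Shelf.act p (treeAct Shelf.act q r) =
      treeAct Shelf.act (treeAct Shelf.act p q) (treeAct (Shelf.act (α := α)) p r) := by
  induction p using FreeMagma.recOnMul generalizing q r with
  | ih1 a =>
    induction q using FreeMagma.recOnMul generalizing r with
    | ih1 b =>
      induction r using FreeMagma.recOnMul with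
      | ih1 c => exact congrArg FreeMagma.of Shelf.self_distrib
      | ih2 r₁ r₂ h₁ h₂ => simp only [treeAct_mul_right, h₁, h₂]
    | ih2 q₁ q₂ h₁ h₂ => simp only [treeAct_mul_right, treeAct_mul, h₁, h₂]
  | ih2 p₁ p₂ h₁ h₂ => simp only [treeAct_mul, h₁, h₂]

/-- The binary trees with leaves in a shelf form an augmented LD-system, where `∘` is the grafting
of trees. -/
instance [Shelf α] : ALDSystem (FreeMagma α) where
  act := treeAct Shelf.act
  self_distrib := treeAct_self_distrib _ _ _
  comp p q := p * q
  act_act _ _ _ := rfl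
  act_comp _ _ _ := treeAct_mul_right _ _ _ _

/-- The `∘`-term underlying a tree. -/
def shape : FreeMagma α → CompTerm
  | .of _ => .x
  | .mul p q => .comp (shape p) (shape q)

/-- The sequence of leaves of a tree, from left to right. -/
def leaves : (p : FreeMagma α) → Fin (shape p).size → α
  | .of a => fun _ => a
  | .mul p q => Fin.append (leaves p) (leaves q)

end Trees

/-- The evaluation at `γ` of a tree of `∗`-terms. -/
def treeEval {S : Type*} [ALDSystem S] (γ : S) : FreeMagma StarTerm → S
  | .of s => s.eval γ
  | .mul p q => ALDSystem.comp (treeEval γ p) (treeEval γ q)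

theorem subst_shape_leaves_eval {S : Type*} [ALDSystem S] (γ : S) (p : FreeMagma StarTerm) :
    ((shape p).subst (leaves p)).eval γ = treeEval γ p := by
  induction p with
  | ih1 s => exact s.eval_toTerm γ
  | ih2 p q hp hq =>
    have hl : (fun i => Fin.append (leaves p) (leaves q) (Fin.castAdd _ i)) = leaves p :=
      funext fun i => Fin.append_left _ _ i
    have hr : (fun i => Fin.append (leaves p) (leaves q) (Fin.natAdd _ i)) = leaves q :=
      funext fun i => Fin.append_right _ _ i
    refine congrArg₂ ALDSystem.comp (Eq.trans ?_ hp) (Eq.trans ?_ hq)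
    · exact congrArg (fun l => ((shape p).subst l).eval γ) hl
    · exact congrArg (fun l => ((shape q).subst l).eval γ) hr

theorem treeEval_treeAct {S : Type*} [ALDSystem S] (γ : S) (p q : FreeMagma StarTerm) :
    treeEval γ (treeAct .star p q) = treeEval γ p ◃ treeEval γ q := by
  induction p using FreeMagma.recOnMul generalizing q with
  | ih1 s =>
    induction q using FreeMagma.recOnMul with
    | ih1 t => rfl
    | ih2 q₁ q₂ h₁ h₂ =>
      rw [treeAct_mul_right]
      exact (congrArg₂ ALDSystem.comp h₁ h₂).trans (ALDSystem.act_comp _ _ _).symm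
  | ih2 p₁ p₂ h₁ h₂ =>
    rw [treeAct_mul, h₁, h₂]
    exact ALDSystem.act_act _ _ _

/-- The normal form of a term, in which no `∘` lies below a `∗`. -/
def Term.normalForm : Term → FreeMagma StarTerm
  | .x => .of .x
  | .star s t => treeAct .star s.normalForm t.normalForm
  | .comp s t => .mul s.normalForm t.normalForm

theorem Term.treeEval_normalForm {S : Type*} [ALDSystem S] (γ : S) (t : Term) :
    treeEval γ t.normalForm = t.eval γ := by
  induction t with
  | x => rfl
  | star s t hs ht => simp only [normalForm, treeEval_treeAct, Term.eval, hs, ht]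
  | comp s t hs ht => simp only [normalForm, treeEval, Term.eval, hs, ht]

/-! ### From the absence of collisions to freeness -/

theorem CompTerm.Less.irrefl (u : CompTerm) : ¬ u.Less u := by
  intro h
  induction u with
  | x =>
    cases h with
    | base h => exact h rfl
  | comp u v hu hv =>
    cases h with
    | left h => exact hu h
    | right h => exact hv h

theorem CompTerm.Less.trichotomy (u v : CompTerm) : u.Less v ∨ u = v ∨ v.Less u := by
  induction u generalizing v with
  | x =>
    by_cases h : v = .x
    · exact .inr (.inl h.symm)
    · exact .inl (.base h)
  | comp u₁ u₂ h₁ h₂ =>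
    cases v with
    | x => exact .inr (.inr (.base (by simp)))
    | comp v₁ v₂ =>
      obtain h | rfl | h := h₁ v₁
      · exact .inl (.left h)
      · obtain h | rfl | h := h₂ v₂
        · exact .inl (.right h)
        · exact .inr (.inl rfl)
        · exact .inr (.inr (.right h))
      · exact .inr (.inr (.left h))

theorem CompTerm.subst_eval_congr {S : Type*} [ALDSystem S] (γ : S) (u : CompTerm)
    {s t : Fin u.size → StarTerm} (h : ∀ i, (s i).eval γ = (t i).eval γ) :
    (u.subst s).eval γ = (u.subst t).eval γ := by
  induction u with
  | x => simpa only [subst, StarTerm.eval_toTerm] using h _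
  | comp u v hu hv =>
    exact congrArg₂ ALDSystem.comp (hu fun i => h (Fin.castAdd v.size i))
      (hv fun i => h (Fin.natAdd u.size i))

/-- Two sequences of `∗`-terms that are not termwise equivalent have equivalents that are comparable
with respect to the lexicographic extension of `⊏`. -/
theorem SeqIterLeft.comparison {p : ℕ} (s t : Fin p → StarTerm) :
    (∀ i, (s i).LDEquiv (t i)) ∨
      ∃ s' t' : Fin p → StarTerm, (∀ i, (s i).LDEquiv (s' i)) ∧ (∀ i, (t i).LDEquiv (t' i)) ∧
        (SeqIterLeft s' t' ∨ SeqIterLeft t' s') := by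
  by_cases h : ∀ i, (s i).LDEquiv (t i)
  · exact .inl h
  right
  push Not at h
  obtain ⟨k, hk, hmin⟩ := WellFounded.has_min (wellFounded_lt (α := Fin p))
    {i | ¬ (s i).LDEquiv (t i)} h
  have hlt : ∀ i < k, (s i).LDEquiv (t i) := fun i hi => by
    by_contra hn
    exact hmin i hn hi
  obtain hst | ⟨a, b, ha, hb, hab⟩ := StarTerm.comparison (s k) (t k)
  · exact absurd hst hk
  -- Below the first inequivalent index `k` both sequences use the terms of `t`, so that they
  -- literally coincide there.
  refine ⟨fun i => if i < k then t i else if i = k then a else s i,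
    fun i => if i = k then b else t i, fun i => ?_, fun i => ?_, ?_⟩
  · dsimp only
    split_ifs with h₁ h₂
    · exact hlt i h₁
    · exact h₂ ▸ ha
    · exact .refl _
  · dsimp only
    split_ifs with h₁
    · exact h₁ ▸ hb
    · exact .refl _
  · refine hab.imp (fun h => ⟨k, fun i hi => ?_, ?_⟩) (fun h => ⟨k, fun i hi => ?_, ?_⟩)
    · simp [hi, hi.ne]
    · simpa using h
    · simp [hi, hi.ne]
    · simpa using h

theorem GeneratedBy.exists_eval_eq {S : Type*} [ALDSystem S] {γ : S} (hγ : GeneratedBy S γ)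
    (a : S) : ∃ t : Term, t.eval γ = a := by
  have h := hγ (Set.range (Term.eval γ)) ⟨.x, rfl⟩
    (by rintro _ ⟨s, rfl⟩ _ ⟨t, rfl⟩; exact ⟨.star s t, rfl⟩)
    (by rintro _ ⟨s, rfl⟩ _ ⟨t, rfl⟩; exact ⟨.comp s t, rfl⟩)
  exact h.symm.subset (Set.mem_univ a)

theorem IsHom.map_eval {S T : Type*} [ALDSystem S] [ALDSystem T] {f : S → T} (hf : IsHom f)
    (γ : S) (t : Term) : f (t.eval γ) = t.eval (f γ) := by
  induction t with
  | x => rfl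
  | star s t hs ht => simp only [Term.eval, hf.1, hs, ht]
  | comp s t hs ht => simp only [Term.eval, hf.2, hs, ht]

/-- If every equality between values of terms at `γ` holds in all augmented LD-systems, then the
system generated by `γ` is free. -/
theorem GeneratedBy.isFreeOn {S : Type u} [ALDSystem S] {γ : S} (hγ : GeneratedBy S γ)
    (h : ∀ s t : Term, s.eval γ = t.eval γ →
      ∀ (T : Type w) [ALDSystem T] (a : T), s.eval a = t.eval a) :
    IsFreeOn.{u, w} S γ := by
  intro T _ a
  choose r hr using hγ.exists_eval_eq
  have hr' (t : Term) : (r (t.eval γ)).eval a = t.eval a := h _ _ (hr _) T a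
  refine ⟨fun b => (r b).eval a, ⟨⟨fun b c => ?_, fun b c => ?_⟩, hr' .x⟩, ?_⟩
  · have := hr' (.star (r b) (r c))
    simpa only [Term.eval, hr] using this
  · have := hr' (.comp (r b) (r c))
    simpa only [Term.eval, hr] using this
  · rintro f ⟨hf, rfl⟩
    funext b
    rw [← hf.map_eval, hr]

theorem eval_eq_of_no_collision {S : Type u} [ALDSystem S] {γ : S}
    (hless : ∀ (u v : CompTerm) (s : Fin u.size → StarTerm) (t : Fin v.size → StarTerm),
      u.Less v → (u.subst s).eval γ ≠ (v.subst t).eval γ)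
    (hseq : ∀ (u : CompTerm) (s t : Fin u.size → StarTerm),
      SeqIterLeft s t → (u.subst s).eval γ ≠ (u.subst t).eval γ)
    (s t : Term) (h : s.eval γ = t.eval γ) (T : Type w) [ALDSystem T] (a : T) :
    s.eval a = t.eval a := by
  have key : ∀ (u v : CompTerm) (p : Fin u.size → StarTerm) (q : Fin v.size → StarTerm),
      (u.subst p).eval γ = (v.subst q).eval γ → (u.subst p).eval a = (v.subst q).eval a := by
    intro u v p q hpq
    obtain huv | rfl | hvu := CompTerm.Less.trichotomy u v
    · exact absurd hpq (hless u v p q huv)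
    · obtain hall | ⟨p', q', hp, hq, hpq'⟩ := SeqIterLeft.comparison p q
      · exact u.subst_eval_congr a fun i => (hall i).eval_eq a
      · have h' : (u.subst p').eval γ = (u.subst q').eval γ := by
          rw [← u.subst_eval_congr γ fun i => (hp i).eval_eq γ,
            ← u.subst_eval_congr γ fun i => (hq i).eval_eq γ, hpq]
        obtain hlex | hlex := hpq'
        · exact absurd h' (hseq u p' q' hlex)
        · exact absurd h'.symm (hseq u q' p' hlex)
    · exact absurd hpq.symm (hless v u q p hvu)
  have := key (shape s.normalForm) (shape t.normalForm) (leaves s.normalForm) (leaves t.normalForm)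
  simp only [subst_shape_leaves_eval, Term.treeEval_normalForm] at this
  exact this h

/-! ### Shifted conjugacy and the Artin automorphism -/

/-- The shifted conjugacy operation `a ∗ b = a sh(b) σ sh(a)⁻¹` on a group. -/
abbrev shiftedConjShelf {G : Type*} [Group G] (sh : G →* G) (σ : G)
    (hcomm : ∀ a, Commute σ (sh (sh a))) (hbraid : σ * sh σ * σ = sh σ * σ * sh σ) : Shelf G where
  act a b := a * sh b * σ * (sh a)⁻¹
  self_distrib := by
    -- Both sides reduce to `a sh(b) sh²(c) · sh(σ) σ · sh²(b)⁻¹ sh(a)⁻¹`; on the right the middle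
    -- is first `σ sh(σ) σ sh(σ)⁻¹`, and the braid relation applies.
    intro a b c
    have h₁ : (sh (sh a))⁻¹ * (σ * sh (sh a)) = σ := by
      rw [(hcomm a).eq, inv_mul_cancel_left]
    have h₂ : σ * (sh σ * (σ * (sh σ)⁻¹)) = sh σ * σ := by
      rw [← mul_assoc, ← mul_assoc, hbraid, mul_inv_cancel_right]
    have h₃ : (sh (sh b))⁻¹ * σ = σ * (sh (sh b))⁻¹ := ((hcomm b).inv_right.eq).symm
    have h₄ : σ * sh (sh c) = sh (sh c) * σ := (hcomm c).eq
    simp only [map_mul, map_inv, mul_inv_rev, inv_inv, mul_assoc, inv_mul_cancel_left]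
    rw [← mul_assoc (sh (sh a))⁻¹ σ, ← mul_assoc ((sh (sh a))⁻¹ * σ), mul_assoc (sh (sh a))⁻¹, h₁,
      ← mul_assoc σ (sh (sh c)), h₄, ← mul_assoc (sh (sh b))⁻¹ σ, h₃]
    simp only [mul_assoc]
    rw [← mul_assoc (sh σ) σ (_ * _), ← h₂]
    simp only [mul_assoc]

/-- The endomorphism `x₀ ↦ x₀ x₁ x₀⁻¹`, `x₁ ↦ x₀` of a free group of countable rank. -/
def artinHom : FreeGroup ℕ →* FreeGroup ℕ :=
  FreeGroup.lift fun
    | 0 => .of 0 * .of 1 * (.of 0)⁻¹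
    | 1 => .of 0
    | k + 2 => .of (k + 2)

/-- The endomorphism `x₀ ↦ x₁`, `x₁ ↦ x₁⁻¹ x₀ x₁` of a free group of countable rank. -/
def artinInvHom : FreeGroup ℕ →* FreeGroup ℕ :=
  FreeGroup.lift fun
    | 0 => .of 1
    | 1 => (.of 1)⁻¹ * .of 0 * .of 1
    | k + 2 => .of (k + 2)

/-- The Artin automorphism `x₀ ↦ x₀ x₁ x₀⁻¹`, `x₁ ↦ x₀` of a free group of countable rank. -/
def artin : MulAut (FreeGroup ℕ) :=
  MonoidHom.toMulEquiv artinHom artinInvHom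
    (by ext k; obtain _ | _ | k := k <;> simp [artinHom, artinInvHom, mul_assoc])
    (by ext k; obtain _ | _ | k := k <;> simp [artinHom, artinInvHom, mul_assoc])

@[simp]
theorem artin_of_zero : artin (.of 0) = .of 0 * .of 1 * (.of 0)⁻¹ := by
  change artinHom (.of 0) = _
  simp [artinHom]

@[simp]
theorem artin_of_one : artin (.of 1) = .of 0 := by
  change artinHom (.of 1) = _
  simp [artinHom]

@[simp]
theorem artin_of_add_two (k : ℕ) : artin (.of (k + 2)) = .of (k + 2) := by
  change artinHom (.of (k + 2)) = _
  simp [artinHom]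

/-- The shift endomorphism `x_k ↦ x_{k+1}` of a free group of countable rank. -/
abbrev shiftHom : FreeGroup ℕ →* FreeGroup ℕ := FreeGroup.map Nat.succ

/-- The endomorphism fixing `x₀` and acting on the other generators as the shift of `φ`. -/
def shiftEnd (φ : FreeGroup ℕ →* FreeGroup ℕ) : FreeGroup ℕ →* FreeGroup ℕ :=
  FreeGroup.lift fun
    | 0 => .of 0
    | k + 1 => shiftHom (φ (.of k))

@[simp]
theorem shiftEnd_of_zero (φ : FreeGroup ℕ →* FreeGroup ℕ) : shiftEnd φ (.of 0) = .of 0 :=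
  FreeGroup.lift_apply_of

@[simp]
theorem shiftEnd_of_succ (φ : FreeGroup ℕ →* FreeGroup ℕ) (k : ℕ) :
    shiftEnd φ (.of (k + 1)) = shiftHom (φ (.of k)) :=
  FreeGroup.lift_apply_of

theorem shiftEnd_shiftHom (φ : FreeGroup ℕ →* FreeGroup ℕ) (g : FreeGroup ℕ) :
    shiftEnd φ (shiftHom g) = shiftHom (φ g) := by
  have : (shiftEnd φ).comp shiftHom = shiftHom.comp φ := by
    ext k
    simp
  exact DFunLike.congr_fun this g

theorem shiftEnd_comp (φ ψ : FreeGroup ℕ →* FreeGroup ℕ) :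
    shiftEnd (φ.comp ψ) = (shiftEnd φ).comp (shiftEnd ψ) := by
  ext k
  obtain _ | k := k
  · simp
  · simp [shiftEnd_shiftHom]

theorem shiftEnd_id : shiftEnd (.id _) = .id _ := by
  ext k
  obtain _ | k := k <;> simp

/-- The shift endomorphism of the automorphism group of a free group of countable rank. -/
def shift : MulAut (FreeGroup ℕ) →* MulAut (FreeGroup ℕ) where
  toFun φ := MonoidHom.toMulEquiv (shiftEnd φ.toMonoidHom) (shiftEnd φ.symm.toMonoidHom)
    (by rw [← shiftEnd_comp, ← shiftEnd_id]; congr 1; ext; simp)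
    (by rw [← shiftEnd_comp, ← shiftEnd_id]; congr 1; ext; simp)
  map_one' := by
    ext g
    exact DFunLike.congr_fun shiftEnd_id g
  map_mul' φ ψ := by
    ext g
    exact DFunLike.congr_fun (shiftEnd_comp φ.toMonoidHom ψ.toMonoidHom) g

@[simp]
theorem shift_of_zero (φ : MulAut (FreeGroup ℕ)) : shift φ (.of 0) = .of 0 :=
  shiftEnd_of_zero φ.toMonoidHom

theorem shift_shiftHom (φ : MulAut (FreeGroup ℕ)) (g : FreeGroup ℕ) :
    shift φ (shiftHom g) = shiftHom (φ g) :=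
  shiftEnd_shiftHom φ.toMonoidHom g

@[simp]
theorem shift_of_succ (φ : MulAut (FreeGroup ℕ)) (k : ℕ) :
    shift φ (.of (k + 1)) = shiftHom (φ (.of k)) :=
  shiftEnd_of_succ φ.toMonoidHom k

theorem mulAut_ext {φ ψ : MulAut (FreeGroup ℕ)} (h : ∀ k, φ (.of k) = ψ (.of k)) : φ = ψ := by
  have : φ.toMonoidHom = ψ.toMonoidHom := FreeGroup.ext_hom _ _ h
  ext g
  exact DFunLike.congr_fun this g

theorem artin_shiftHom_shiftHom (g : FreeGroup ℕ) :
    artin (shiftHom (shiftHom g)) = shiftHom (shiftHom g) := by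
  have : (artin.toMonoidHom.comp shiftHom).comp shiftHom = shiftHom.comp shiftHom := by
    ext k
    simp
  exact DFunLike.congr_fun this g

theorem commute_artin_shift_shift (φ : MulAut (FreeGroup ℕ)) :
    Commute artin (shift (shift φ)) := by
  refine mulAut_ext fun k => ?_
  have h₁ : shift (shift φ) (.of 1) = .of 1 := by
    rw [shift_of_succ (shift φ) 0, shift_of_zero]
    rfl
  obtain _ | _ | k := k
  · simp [h₁]
  · simp [h₁]
  · simp [artin_shiftHom_shiftHom]

theorem artin_braid : artin * shift artin * artin = shift artin * artin * shift artin := by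
  have h₁ : shift artin (.of 1) = .of 1 * .of 2 * (.of 1)⁻¹ := by
    rw [shift_of_succ artin 0]
    simp
  have h₂ : shift artin (.of 2) = .of 1 := by
    rw [shift_of_succ artin 1]
    simp
  have h₃ : artin (.of 2) = .of 2 := artin_of_add_two 0
  refine mulAut_ext fun k => ?_
  obtain _ | _ | _ | k := k
  · simp [h₁, h₃, mul_assoc]
  · simp [h₁, h₃, mul_assoc]
  · simp [h₂, h₃, mul_assoc]
  · have : shift artin (.of (k + 3)) = .of (k + 3) := by simp
    simp [this, artin_of_add_two (k + 1)]

/-- The automorphisms of a free group of countable rank, with shifted conjugacy. -/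
instance freeGroupShelf : Shelf (MulAut (FreeGroup ℕ)) :=
  shiftedConjShelf shift artin commute_artin_shift_shift artin_braid

/-! ### First letters of reduced words under `artin` and `shift` -/

/-- The reduced word obtained by multiplying a reduced word by a letter on the left. -/
def pushLetter (a : ℕ × Bool) : List (ℕ × Bool) → List (ℕ × Bool)
  | [] => [a]
  | b :: l => if a.1 = b.1 ∧ a.2 = !b.2 then l else a :: b :: l

theorem reduce_cons_eq_pushLetter (a : ℕ × Bool) (l : List (ℕ × Bool)) :
    FreeGroup.reduce (a :: l) = pushLetter a (FreeGroup.reduce l) := by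
  rw [FreeGroup.reduce.cons]
  cases FreeGroup.reduce l <;> rfl

theorem toWord_of_mul (k : ℕ) (g : FreeGroup ℕ) :
    (FreeGroup.of k * g).toWord = pushLetter (k, true) g.toWord := by
  rw [FreeGroup.toWord_mul, FreeGroup.toWord_of, List.singleton_append,
    reduce_cons_eq_pushLetter, FreeGroup.reduce_toWord]

theorem toWord_of_inv_mul (k : ℕ) (g : FreeGroup ℕ) :
    ((FreeGroup.of k)⁻¹ * g).toWord = pushLetter (k, false) g.toWord := by
  have : ((FreeGroup.of k)⁻¹).toWord = [(k, false)] := by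
    rw [FreeGroup.toWord_inv, FreeGroup.toWord_of]
    rfl
  rw [FreeGroup.toWord_mul, this, List.singleton_append,
    reduce_cons_eq_pushLetter, FreeGroup.reduce_toWord]

theorem mk_cons_true (k : ℕ) (l : List (ℕ × Bool)) :
    FreeGroup.mk ((k, true) :: l) = .of k * .mk l := rfl

theorem mk_cons_false (k : ℕ) (l : List (ℕ × Bool)) :
    FreeGroup.mk ((k, false) :: l) = (.of k)⁻¹ * .mk l := rfl

/-- The possible beginnings of the reduced word of the image under `artin` of an element, in terms
of the first letter of its reduced word. -/
def ArtinImage : Option (ℕ × Bool) → List (ℕ × Bool) → Prop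
  | none, r => r = []
  | some (0, e), r => r[0]? = some (0, true) ∧ r[1]? = some (1, e)
  | some (1, true), r => r[0]? = some (0, true) ∧ r[1]? ≠ some (1, true) ∧ r[1]? ≠ some (1, false)
  | some (1, false), r => r[0]? = some (0, false) ∨ r[0]? = some (1, true) ∨ r[0]? = some (1, false)
  | some (k + 2, e), r => r[0]? = some (k + 2, e)

/-- Only the case of first letter `x₀` is used later; the others make the induction close. For
instance, before a tail starting with `x₁`, the prefix `x₀ x₁^e x₀⁻¹` loses its last letter, and the
condition on `r[1]` stops further cancellation. -/
theorem artinImage_mk (l : List (ℕ × Bool)) (hl : FreeGroup.IsReduced l) :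
    ArtinImage l.head? (artin (FreeGroup.mk l)).toWord := by
  induction l with
  | nil => simp [ArtinImage, ← FreeGroup.one_eq_mk]
  | cons x l ih =>
    have ih := ih (hl.infix (List.suffix_cons x l).isInfix)
    have hx : ∀ y ∈ l.head?, x.1 = y.1 → x.2 = y.2 := by
      cases l with
      | nil => simp
      | cons y l => simpa using (FreeGroup.isReduced_cons_cons.1 hl).1
    generalize l.head? = h at ih hx
    obtain ⟨k, e⟩ := x
    obtain _ | _ | k := k <;> cases e <;>
      simp only [mk_cons_true, mk_cons_false, map_mul, map_inv, artin_of_zero, artin_of_one,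
        artin_of_add_two, mul_inv_rev, inv_inv, mul_assoc, zero_add, toWord_of_mul,
        toWord_of_inv_mul, List.head?_cons] <;>
      generalize (artin (FreeGroup.mk l)).toWord = r at ih ⊢ <;>
      obtain _ | ⟨_ | _ | j, _ | _⟩ := h <;>
      simp only [ArtinImage, Option.mem_def, Option.some.injEq, forall_eq'] at ih hx ⊢ <;>
      obtain _ | ⟨⟨a, _ | _⟩, _ | ⟨⟨b, _ | _⟩, r⟩⟩ := r <;>
      grind [pushLetter]

/-- The reduced word of `g` begins with `x₀`. -/
def BeginsWithZero (g : FreeGroup ℕ) : Prop := g.toWord.head? = some (0, true)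

theorem BeginsWithZero.artin {g : FreeGroup ℕ} (h : BeginsWithZero g) :
    BeginsWithZero (artin g) := by
  have := artinImage_mk g.toWord FreeGroup.isReduced_toWord
  rw [h, FreeGroup.mk_toWord] at this
  rw [BeginsWithZero, List.head?_eq_getElem?]
  exact this.1

/-- The shift of a word. -/
abbrev shiftWord (l : List (ℕ × Bool)) : List (ℕ × Bool) := l.map fun a => (a.1 + 1, a.2)

theorem isReduced_shiftWord {l : List (ℕ × Bool)} :
    FreeGroup.IsReduced (shiftWord l) ↔ FreeGroup.IsReduced l := by
  simp [FreeGroup.IsReduced, List.isChain_map]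

theorem toWord_shiftHom (g : FreeGroup ℕ) : (shiftHom g).toWord = shiftWord g.toWord := by
  have : shiftHom g = FreeGroup.mk (shiftWord g.toWord) := by
    conv_lhs => rw [← FreeGroup.mk_toWord (x := g)]
    exact FreeGroup.map.mk
  rw [this, FreeGroup.toWord_mk]
  exact (isReduced_shiftWord.2 FreeGroup.isReduced_toWord).reduce_eq

theorem exists_eq_shiftWord_append (l : List (ℕ × Bool)) :
    ∃ s r, l = shiftWord s ++ r ∧ ∀ a ∈ r.head?, a.1 = 0 := by
  induction l with
  | nil => exact ⟨[], [], rfl, by simp⟩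
  | cons x l ih =>
    obtain ⟨_ | k, e⟩ := x
    · exact ⟨[], _, rfl, by simp⟩
    · obtain ⟨s, r, rfl, hr⟩ := ih
      exact ⟨(k, e) :: s, r, rfl, hr⟩

/-- Split the word into an initial block without `x₀` and a rest starting with `x₀^±1`. The block
has a shifted image, which cannot cancel against the image of the rest, itself starting with `x₀^±1`
by induction. -/
theorem head?_shift_mk (φ : MulAut (FreeGroup ℕ)) (l : List (ℕ × Bool))
    (hl : FreeGroup.IsReduced l) (e : Bool) :
    (shift φ (FreeGroup.mk l)).toWord.head? = some (0, e) ↔ l.head? = some (0, e) := by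
  induction hn : l.length using Nat.strong_induction_on generalizing l e with
  | h n ih =>
    subst hn
    obtain ⟨s, r, rfl, hr⟩ := exists_eq_shiftWord_append l
    have hsr := (List.isChain_append.1 hl)
    obtain _ | ⟨x, s⟩ := s
    · obtain _ | ⟨⟨k, d⟩, r⟩ := r
      · simp [← FreeGroup.one_eq_mk]
      · obtain rfl : k = 0 := hr _ rfl
        have hd : r.head? ≠ some (0, !d) := by
          cases r with
          | nil => simp
          | cons y r =>
            have := (FreeGroup.isReduced_cons_cons.1 hl).1
            rintro h
            obtain rfl : y = (0, !d) := by simpa using h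
            simp at this
        -- The converse implication, for the opposite sign, shows that the new letter `x₀^±1` does
        -- not cancel.
        have hW := (ih r.length (by simp) r (hl.infix (List.suffix_cons _ r).isInfix) (!d)
          rfl).not.2 hd
        have hpush : (shift φ (FreeGroup.mk ((0, d) :: r))).toWord =
            pushLetter (0, d) (shift φ (FreeGroup.mk r)).toWord := by
          cases d
          · rw [mk_cons_false, map_mul, map_inv, shift_of_zero, toWord_of_inv_mul]
          · rw [mk_cons_true, map_mul, shift_of_zero, toWord_of_mul]
        have hhead : (shift φ (FreeGroup.mk ((0, d) :: r))).toWord.head? = some (0, d) := by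
          rw [hpush]
          generalize (shift φ (FreeGroup.mk r)).toWord = W at hW
          cases W with
          | nil => rfl
          | cons y W =>
            rw [pushLetter, if_neg]
            · rfl
            · rintro ⟨h₁, h₂⟩
              refine hW (congrArg some (Prod.ext h₁.symm ?_))
              rw [show d = !y.2 from h₂, Bool.not_not]
        rw [show shiftWord [] ++ (0, d) :: r = (0, d) :: r from rfl, hhead]
        rfl
    · set t := x :: s with ht
      -- Injectivity of `φ` keeps the image of the block nonempty, so the `x₀^±1` behind it does not
      -- surface.
      have hne : φ (FreeGroup.mk t) ≠ 1 := by
        rw [Ne, EmbeddingLike.map_eq_one_iff, ← FreeGroup.toWord_eq_nil_iff, FreeGroup.toWord_mk,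
          (isReduced_shiftWord.1 hsr.1).reduce_eq]
        exact List.cons_ne_nil _ _
      have hmk : FreeGroup.mk (shiftWord t ++ r) = shiftHom (FreeGroup.mk t) * FreeGroup.mk r := by
        rw [shiftHom, FreeGroup.map.mk, FreeGroup.mul_mk]
      have hr' : ∀ a ∈ (shift φ (FreeGroup.mk r)).toWord.head?, a.1 = 0 := by
        obtain _ | ⟨⟨k, d⟩, r⟩ := r
        · simp [← FreeGroup.one_eq_mk]
        · obtain rfl : k = 0 := hr _ rfl
          have := (ih ((0, d) :: r).length (by simp [ht]) _ hsr.2.1 d rfl).2 rfl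
          intro a ha
          rw [Option.mem_def, this] at ha
          obtain rfl := Option.some.inj ha
          rfl
      have hword : (shift φ (FreeGroup.mk (shiftWord t ++ r))).toWord =
          shiftWord (φ (FreeGroup.mk t)).toWord ++ (shift φ (FreeGroup.mk r)).toWord := by
        rw [hmk, map_mul, shift_shiftHom, FreeGroup.toWord_mul, toWord_shiftHom]
        refine FreeGroup.IsReduced.reduce_eq (List.isChain_append.2
          ⟨isReduced_shiftWord.2 FreeGroup.isReduced_toWord, FreeGroup.isReduced_toWord, ?_⟩)
        intro a ha b hb hab
        rw [hr' b hb] at hab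
        obtain ⟨c, -, rfl⟩ := List.mem_map.1 (List.mem_of_getLast? ha)
        exact absurd hab (Nat.succ_ne_zero _)
      rw [hword]
      rw [Ne, ← FreeGroup.toWord_eq_nil_iff] at hne
      obtain ⟨y, W, hW⟩ := List.exists_cons_of_ne_nil hne
      rw [hW, ht]
      simp

theorem BeginsWithZero.shift {g : FreeGroup ℕ} (h : BeginsWithZero g) (φ : MulAut (FreeGroup ℕ)) :
    BeginsWithZero (shift φ g) := by
  have := head?_shift_mk φ g.toWord FreeGroup.isReduced_toWord true
  rw [FreeGroup.mk_toWord] at this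
  exact this.2 h

/-! ### Positive automorphisms and acyclicity of left division -/

/-- An automorphism is positive if it maps `x₀⁻¹` and all the elements whose reduced word begins
with `x₀` to elements whose reduced word begins with `x₀`. -/
def IsPositive (φ : MulAut (FreeGroup ℕ)) : Prop :=
  BeginsWithZero (φ (.of 0)⁻¹) ∧ ∀ g, BeginsWithZero g → BeginsWithZero (φ g)

theorem IsPositive.mul {φ ψ : MulAut (FreeGroup ℕ)} (hφ : IsPositive φ) (hψ : IsPositive ψ) :
    IsPositive (φ * ψ) :=
  ⟨hφ.2 _ hψ.1, fun g hg => hφ.2 _ (hψ.2 g hg)⟩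

theorem not_isPositive_one : ¬ IsPositive 1 := by
  rintro ⟨h, -⟩
  have : ((FreeGroup.of 0)⁻¹ : FreeGroup ℕ).toWord = [(0, false)] := by
    rw [FreeGroup.toWord_inv, FreeGroup.toWord_of]
    rfl
  simp [BeginsWithZero, this] at h

/-- `shift ψ` fixes `x₀⁻¹`, `artin` sends it to `x₀ x₁⁻¹ x₀⁻¹`, and all three factors preserve an
initial `x₀`. -/
theorem isPositive_shift_artin_shift (φ ψ : MulAut (FreeGroup ℕ)) :
    IsPositive (shift φ * artin * shift ψ) := by
  refine ⟨?_, fun g hg => ((hg.shift ψ).artin).shift φ⟩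
  have h : artin (.of 0)⁻¹ = .of 0 * ((.of 1)⁻¹ * (.of 0)⁻¹) := by simp
  have hpos : BeginsWithZero (artin (.of 0)⁻¹) := by
    rw [h, BeginsWithZero, toWord_of_mul, toWord_of_inv_mul, FreeGroup.toWord_inv,
      FreeGroup.toWord_of]
    rfl
  simpa only [MulAut.mul_apply, map_inv, shift_of_zero] using hpos.shift φ

theorem isPositive_inv_mul_act (a b : MulAut (FreeGroup ℕ)) : IsPositive (a⁻¹ * (a ◃ b)) := by
  have : a⁻¹ * (a ◃ b) = shift b * artin * shift a⁻¹ := by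
    change a⁻¹ * (a * shift b * artin * (shift a)⁻¹) = _
    rw [map_inv]
    group
  rw [this]
  exact isPositive_shift_artin_shift _ _

/-- Left division in the shelf of automorphisms of the free group has no cycles. -/
theorem StarTerm.IterLeft.eval_ne {s t : StarTerm} (h : s.IterLeft t) (g : MulAut (FreeGroup ℕ)) :
    s.eval g ≠ t.eval g := by
  have key : IsPositive ((s.eval g)⁻¹ * t.eval g) := by
    induction t with
    | x => exact absurd h (StarTerm.not_iterLeft_x s)
    | star p q ih =>
      have hpq := isPositive_inv_mul_act (p.eval g) (q.eval g)
      obtain rfl | h := StarTerm.iterLeft_star.1 h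
      · exact hpq
      · have := (ih h).mul hpq
        rwa [mul_assoc, mul_inv_cancel_left] at this
  intro heq
  rw [heq, inv_mul_cancel] at key
  exact not_isPositive_one key

/-- Lifts the automorphism shelf to the universe of the systems against which freeness is tested. -/
instance {L : Type*} [Shelf L] : Shelf (ULift.{w} L) where
  act a b := ⟨a.down ◃ b.down⟩
  self_distrib := congrArg ULift.up Shelf.self_distrib

theorem StarTerm.eval_down {L : Type*} [Shelf L] (g : ULift.{w} L) (s : StarTerm) :
    (s.eval g).down = s.eval g.down := by
  induction s with
  | x => rfl
  | star s t hs ht =>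
    change (s.eval g).down ◃ (t.eval g).down = _
    rw [hs, ht, eval]

/-! ### Recovering shapes and leaves from values in the tree model, and the conclusion -/

section TreeModel

variable {L : Type*} [Shelf L] (g : L)

theorem StarTerm.eval_of (s : StarTerm) :
    s.eval (FreeMagma.of g) = FreeMagma.of (s.eval g) := by
  induction s with
  | x => rfl
  | star s t hs ht =>
    rw [eval, hs, ht]
    rfl

theorem CompTerm.shape_subst_eval (u : CompTerm) (s : Fin u.size → StarTerm) :
    shape ((u.subst s).eval (FreeMagma.of g)) = u := by
  induction u with
  | x =>
    rw [subst, StarTerm.eval_toTerm, StarTerm.eval_of]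
    rfl
  | comp u v hu hv => exact congrArg₂ CompTerm.comp (hu _) (hv _)

theorem CompTerm.eval_eq_of_subst_eval_eq (u : CompTerm) (s t : Fin u.size → StarTerm)
    (h : (u.subst s).eval (FreeMagma.of g) = (u.subst t).eval (FreeMagma.of g)) (i : Fin u.size) :
    (s i).eval g = (t i).eval g := by
  induction u with
  | x =>
    simp only [subst, StarTerm.eval_toTerm, StarTerm.eval_of] at h
    obtain rfl : i = (0 : Fin 1) := Subsingleton.elim (α := Fin 1) _ _
    injection h
  | comp u v hu hv =>
    injection h with h₁ h₂
    exact Fin.addCases (motive := fun i => (s i).eval g = (t i).eval g) (hu _ _ h₁) (hv _ _ h₂) i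

end TreeModel

end ALD

theorem proposition2p6 (S : Type u) [ALD.ALDSystem S] (γ : S) (hγ : ALD.GeneratedBy S γ) :
    ALD.IsFreeOn.{u, w} S γ ↔
      (∀ (u v : ALD.CompTerm) (s : Fin u.size → ALD.StarTerm) (t : Fin v.size → ALD.StarTerm),
          u.Less v → (u.subst s).eval γ ≠ (v.subst t).eval γ) ∧
        ∀ (u : ALD.CompTerm) (s t : Fin u.size → ALD.StarTerm),
          ALD.SeqIterLeft s t → (u.subst s).eval γ ≠ (u.subst t).eval γ := by
  constructor
  · intro hfree
    -- The choice of the leaf `1` is immaterial: acyclicity holds for every automorphism as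
    -- generator.
    obtain ⟨f, ⟨hf, hfγ⟩, -⟩ := hfree (FreeMagma (ULift.{w} (MulAut (FreeGroup ℕ))))
      (FreeMagma.of ⟨1⟩)
    have himage {p q : ALD.Term} (h : p.eval γ = q.eval γ) :
        p.eval (FreeMagma.of (ULift.up.{w} (1 : MulAut (FreeGroup ℕ)))) =
          q.eval (FreeMagma.of ⟨1⟩) := by
      rw [← hfγ, ← hf.map_eval, ← hf.map_eval, h]
    refine ⟨fun u v s t huv h => ?_, fun u s t ⟨k, _, hk⟩ h => ?_⟩
    · have h' := congrArg ALD.shape (himage h)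
      rw [ALD.CompTerm.shape_subst_eval, ALD.CompTerm.shape_subst_eval] at h'
      exact ALD.CompTerm.Less.irrefl v (h' ▸ huv)
    · have h' := congrArg ULift.down (u.eval_eq_of_subst_eval_eq _ s t (himage h) k)
      rw [ALD.StarTerm.eval_down, ALD.StarTerm.eval_down] at h'
      exact hk.eval_ne _ h'
  · rintro ⟨hless, hseq⟩
    exact hγ.isFreeOn (ALD.eval_eq_of_no_collision hless hseq)
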